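/- Let $T=\mathbb R^2/\mathbb Z^2$ be the closed oriented torus and let $\hat\pi$ be the set of free homotopy classes of loops on $T$. The Goldman Lie algebra $\mathfrak G$ of $T$ over $\mathbb Z$ is the free $\mathbb Z$-module with basis $\hat\pi$, with the bilinear bracket determined by $$[\alpha,\beta]=\sum_{p\in\alpha\cap\beta}\varepsilon(p)\,\alpha*_p\beta ,$$ where $\alpha,\beta$ are represented by smooth loops with transverse intersections, $\varepsilon(p)=\pm1$ is the sign of the intersection at $p$, and $\alpha*_p\beta$ is the class of the loop that follows $\alpha$ once from $p$ to $p$ and then $\beta$ once. Let $a,b$ be the standard generators of $\pi_1(T)$ (the loops going once around the first and the second circle factor), and write $a^ib^j\in\hat\pi$ for the free homotopy class of the corresponding word. **Proposition (lower central series stabilizes).** Let $G_0=\mathfrak G$ and $G_{i}=[\mathfrak G,G_{i-1}]$ for $i\ge1$, where $[\mathfrak G,H]$ denotes the $\mathbb Z$-span of all brackets $[x,y]$ with $x\in\mathfrak G$, $y\in H$. Then for every $i\ge 1$ the term $G_i$ equals the derived algebra $[\mathfrak G,\mathfrak G]$, and $$[\mathfrak G,\mathfrak G]=\big\langle\, \gcd(i,j)\,a^ib^j\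 (i,j\in\mathbb Z),\quad n\,a^n,\ n\,b^n\ (n\in\mathbb Z\setminus\{0\})\,\big\rangle ,$$ the $\mathbb Z$-submodule spanned by these elements (with $\gcd(0,0)=0$). So the lower central series stabilizes after the first step. -/

import Mathlib

open scoped ContDiff

noncomputable section

namespace Goldman

/-! ### Free homotopy classes of loops -/

/-- A loop in `X`: a continuous map `γ : [0,1] → X` with `γ 0 = γ 1`. -/
abbrev Loop (X : Type*) [TopologicalSpace X] : Type _ :=
  {γ : C(unitInterval, X) // γ 0 = γ 1}

/-- Two loops are freely homotopic if they are homotopic through loops. -/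
def freeHomotopySetoid (X : Type*) [TopologicalSpace X] : Setoid (Loop X) where
  r γ δ := ContinuousMap.HomotopicWith γ.1 δ.1 (fun f => f 0 = f 1)
  iseqv :=
    { refl := fun γ => ContinuousMap.HomotopicWith.refl γ.1 γ.2
      symm := fun h => ContinuousMap.HomotopicWith.symm h
      trans := fun h k => ContinuousMap.HomotopicWith.trans h k }

/-- The set of free homotopy classes of loops in `X`. -/
def FreeClass (X : Type*) [TopologicalSpace X] : Type _ :=
  Quotient (freeHomotopySetoid X)

/-- A closed path, seen as a loop whose base point is forgotten. -/
def Loop.ofPath {X : Type*} [TopologicalSpace X] {x : X} (p : Path x x) : Loop X :=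
  ⟨p.toContinuousMap, by simp⟩

/-- The free homotopy class of a closed path. -/
def FreeClass.ofPath {X : Type*} [TopologicalSpace X] {x : X} (p : Path x x) : FreeClass X :=
  Quotient.mk (freeHomotopySetoid X) (Loop.ofPath p)

theorem FreeClass.ofPath_eq {X : Type*} [TopologicalSpace X] {x : X} {p q : Path x x}
    (h : p.Homotopic q) : FreeClass.ofPath p = FreeClass.ofPath q := by
  obtain ⟨F⟩ := h
  refine Quotient.sound ⟨⟨F.toHomotopy, fun t => ?_⟩⟩
  exact (F.source t).trans (F.target t).symm

/-- The free homotopy class of an element of the fundamental group. -/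
def FreeClass.ofPi1 {X : Type*} [TopologicalSpace X] {x : X} (g : FundamentalGroup X x) :
    FreeClass X :=
  Quotient.lift (s := Path.Homotopic.setoid x x) FreeClass.ofPath
    (fun _ _ h => FreeClass.ofPath_eq h) g.toPath

/-! ### The closed torus -/

/-- The closed torus `ℝ/ℤ × ℝ/ℤ`, oriented by the standard orientation of `ℝ²`. -/
abbrev Torus : Type := UnitAddCircle × UnitAddCircle

/-- The universal covering `ℝ² → ℝ²/ℤ²`. -/
def cover (v : ℝ × ℝ) : Torus := ((v.1 : UnitAddCircle), (v.2 : UnitAddCircle))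

theorem continuous_cover : Continuous cover := by
  unfold cover
  exact ((AddCircle.continuous_mk' 1).comp continuous_fst).prodMk
    ((AddCircle.continuous_mk' 1).comp continuous_snd)

/-- The loop going once around the first factor of the torus. -/
def pathA : Path (0 : Torus) 0 where
  toFun t := cover (t, 0)
  continuous_toFun := continuous_cover.comp (by fun_prop)
  source' := by simp [cover]
  target' := by simp [cover]

/-- The loop going once around the second factor of the torus. -/
def pathB : Path (0 : Torus) 0 where
  toFun t := cover (0, t)
  continuous_toFun := continuous_cover.comp (by fun_prop)
  source' := by simp [cover]
  target' := by simp [cover]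

/-- The generator `a` of the fundamental group of the torus. -/
def genA : FundamentalGroup Torus 0 :=
  FundamentalGroup.fromPath (Path.Homotopic.Quotient.mk pathA)

/-- The generator `b` of the fundamental group of the torus. -/
def genB : FundamentalGroup Torus 0 :=
  FundamentalGroup.fromPath (Path.Homotopic.Quotient.mk pathB)

/-! ### Smooth loops, intersections, and the Goldman bracket -/

/-- A smooth loop on the torus, given by a smooth lift `ℝ → ℝ²` of the corresponding 1-periodic
curve `ℝ → ℝ²/ℤ²`.  Every smooth closed curve has such a lift, and what is defined below does not
depend on the lift but only on the curve. -/
structure SmoothLoop where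
  lift : ℝ → ℝ × ℝ
  smooth : ContDiff ℝ ∞ lift
  periodic : Function.Periodic (fun s => cover (lift s)) 1

namespace SmoothLoop

/-- The 1-periodic curve on the torus. -/
def curve (α : SmoothLoop) (s : ℝ) : Torus := cover (α.lift s)

theorem continuous_curve (α : SmoothLoop) : Continuous α.curve :=
  continuous_cover.comp α.smooth.continuous

/-- The velocity vector of the curve, the tangent spaces of the torus being identified with `ℝ²`
by the covering. -/
def velocity (α : SmoothLoop) (s : ℝ) : ℝ × ℝ := deriv α.lift s

/-- The loop `α`, run through once from the parameter `s` on. -/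
def pathFrom (α : SmoothLoop) (s : ℝ) : Path (α.curve s) (α.curve s) where
  toFun t := α.curve (s + t)
  continuous_toFun := α.continuous_curve.comp (by fun_prop)
  source' := by simp
  target' := by
    have h : α.curve (s + 1) = α.curve s := α.periodic s
    simpa using h

/-- The free homotopy class of a smooth loop. -/
def freeClass (α : SmoothLoop) : FreeClass Torus := FreeClass.ofPath (α.pathFrom 0)

end SmoothLoop

/-- The intersections of `α` and `β`, as pairs of parameters in a period: a double point `p` of
`α ∩ β` is one such pair (and a point where several branches of `α` and `β` cross counts
once for each pair of a branch of `α` and a branch of `β`). -/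
def crossings (α β : SmoothLoop) : Set (ℝ × ℝ) :=
  {p | p.1 ∈ Set.Ico (0 : ℝ) 1 ∧ p.2 ∈ Set.Ico (0 : ℝ) 1 ∧ α.curve p.1 = β.curve p.2}

/-- The determinant of the ordered pair of the velocity vectors of `α` and of `β`. -/
def velocityDet (α β : SmoothLoop) (p : ℝ × ℝ) : ℝ :=
  (α.velocity p.1).1 * (β.velocity p.2).2 - (α.velocity p.1).2 * (β.velocity p.2).1

/-- `α` and `β` have finitely many intersections, all of them transverse. -/
structure IsTransverse (α β : SmoothLoop) : Prop where
  finite : (crossings α β).Finite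
  transverse : ∀ p ∈ crossings α β, velocityDet α β p ≠ 0

/-- The sign `ε(p)` of an intersection: `1` if the velocity vectors of `α` and `β`, in this order,
match the orientation of the torus, and `-1` if they match the opposite one. -/
def crossingSign (α β : SmoothLoop) (p : ℝ × ℝ) : ℤ :=
  (SignType.sign (velocityDet α β p) : ℤ)

/-- The free homotopy class of `α *_p β`: follow `α` once, starting from the intersection,
and then `β` once. -/
def smoothing (α β : SmoothLoop) (p : crossings α β) : FreeClass Torus :=
  FreeClass.ofPath
    ((α.pathFrom p.1.1).trans ((β.pathFrom p.1.2).cast p.2.2.2 p.2.2.2))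

/-- The underlying module of the Goldman Lie algebra of the torus: the free `ℤ`-module with the
free homotopy classes of loops as a basis. -/
abbrev GoldmanModule : Type := FreeClass Torus →₀ ℤ

/-- The sum of `ε(p) (α *_p β)` over the intersections `p` of `α` and `β`. -/
def crossingSum (α β : SmoothLoop) : GoldmanModule :=
  ∑ᶠ p : crossings α β, Finsupp.single (smoothing α β p) (crossingSign α β p)

open Classical in
/-- The Goldman bracket of two free homotopy classes: the signed sum over the intersections of
transverse smooth representatives.  Such representatives exist, and by Goldman's theorem the sum
does not depend on which ones are taken. -/
def bracketClass (x y : FreeClass Torus) : GoldmanModule :=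
  if h : ∃ r : SmoothLoop × SmoothLoop,
      r.1.freeClass = x ∧ r.2.freeClass = y ∧ IsTransverse r.1 r.2 then
    crossingSum h.choose.1 h.choose.2
  else 0

/-- The Goldman bracket `ℤπ̂ × ℤπ̂ → ℤπ̂`, the bilinear extension of the bracket of classes. -/
def bracket : GoldmanModule →ₗ[ℤ] GoldmanModule →ₗ[ℤ] GoldmanModule :=
  Finsupp.linearCombination ℤ fun x => Finsupp.linearCombination ℤ fun y => bracketClass x y

/-- The derived algebra `[𝔊, 𝔊]`: the submodule spanned by all brackets. -/
def derivedAlgebra : Submodule ℤ GoldmanModule := Submodule.map₂ bracket ⊤ ⊤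

/-- The lower central series: `G₀ = 𝔊`, and `Gᵢ₊₁ = [𝔊, Gᵢ]` is spanned by the brackets `[x, y]`
with `x ∈ 𝔊` and `y ∈ Gᵢ`. -/
def lowerCentralSeries : ℕ → Submodule ℤ GoldmanModule
  | 0 => ⊤
  | i + 1 => Submodule.map₂ bracket ⊤ (lowerCentralSeries i)

/-- The basis element `aⁱbʲ` of the Goldman Lie algebra of the torus. -/
def word (i j : ℤ) : GoldmanModule :=
  Finsupp.single (FreeClass.ofPi1 (genA ^ i * genB ^ j)) 1

end Goldman

end

noncomputable section

namespace Goldman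

open MeasureTheory Filter
open scoped Topology

/-! ### Lifts of loops and lattice points -/

/-! The free homotopy class of a smooth loop on the torus is determined by its winding vector in ℤ²,
and smoothing at any crossing adds the two vectors. So the bracket of the classes of z and w is the
class of z + w times the signed number of crossings, and the analytic heart is that this number
equals det(z, w) (`sum_crossingSign`).

For this, ρ(α(s) - β(t)) det(α'(s), β'(t)) is integrated over a period square, as a functional of a
continuous ρ on the torus. Characters of nonzero frequency give 0
(`intersectionIntegral_mFourier_of_ne`), so by density the functional is det(z, w) times that of any
pair of loops with determinant 1. When ρ is a small bump at 0, a change of variables near each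
crossing gives the sum of the signs times ∫ρ (`eventually_intersectionIntegral_eq`). Comparison with
the two coordinate circles, which cross once, yields the count.

The rest is arithmetic. The coefficient il - jk = i(j + l) - j(i + k) is divisible by gcd(i + k, j +
l). Conversely, Bézout presents gcd(i, j) aⁱbʲ as a bracket with a word aᵏbˡ where gcd(k, l) = 1;
that word already lies in the span, so further bracketing loses nothing (`gcdSpan_le_map₂`). -/

/-- A pair of integers as a point of the plane. -/
def latticePoint (z : ℤ × ℤ) : ℝ × ℝ := ((z.1 : ℝ), (z.2 : ℝ))

theorem latticePoint_add (z w : ℤ × ℤ) :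
    latticePoint (z + w) = latticePoint z + latticePoint w := by
  simp [latticePoint]

theorem latticePoint_injective : Function.Injective latticePoint := by
  intro z w h
  simpa [latticePoint, Prod.ext_iff] using h

theorem unitAddCircle_coe_eq_coe_iff {x y : ℝ} :
    (x : UnitAddCircle) = (y : UnitAddCircle) ↔ ∃ n : ℤ, x = y + n := by
  rw [← sub_eq_zero, ← AddCircle.coe_sub, AddCircle.coe_eq_zero_iff]
  simp only [zsmul_eq_mul, mul_one]
  exact exists_congr fun n => ⟨fun h => by linarith, fun h => by linarith⟩

theorem cover_eq_cover_iff {v w : ℝ × ℝ} :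
    cover v = cover w ↔ ∃ z : ℤ × ℤ, v = w + latticePoint z := by
  simp only [cover, Prod.ext_iff, unitAddCircle_coe_eq_coe_iff, latticePoint, Prod.fst_add,
    Prod.snd_add, Prod.exists, exists_and_left, exists_and_right]

theorem cover_add (v w : ℝ × ℝ) : cover (v + w) = cover v + cover w := rfl

theorem cover_sub (v w : ℝ × ℝ) : cover (v - w) = cover v - cover w := rfl

theorem cover_latticePoint (z : ℤ × ℤ) : cover (latticePoint z) = 0 := by
  have : cover (latticePoint z) = cover 0 := cover_eq_cover_iff.2 ⟨z, by simp⟩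
  simpa [cover] using this

theorem cover_eq_zero_iff {v : ℝ × ℝ} : cover v = 0 ↔ ∃ z : ℤ × ℤ, v = latticePoint z := by
  have h0 : cover 0 = 0 := by simp [cover]
  rw [← h0, cover_eq_cover_iff]
  simp

theorem cover_add_latticePoint (v : ℝ × ℝ) (z : ℤ × ℤ) :
    cover (v + latticePoint z) = cover v := by
  rw [cover_add, cover_latticePoint, add_zero]

/-- The straight closed path in the torus that lifts to the segment from `0` to `z`. -/
def linePath (z : ℤ × ℤ) : Path (0 : Torus) 0 where
  toFun t := cover ((t : ℝ) • latticePoint z)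
  continuous_toFun := continuous_cover.comp (by fun_prop)
  source' := by simp [cover]
  target' := by simp [cover_latticePoint]

/-- The free homotopy class of the straight closed path. -/
def lineClass (z : ℤ × ℤ) : FreeClass Torus := FreeClass.ofPath (linePath z)

/-- The straight-line homotopy in the plane from the lift to the segment projects to a homotopy
through loops: at every stage the two ends differ by the same lattice point z. -/
theorem mk_eq_lineClass (γ : Loop Torus) (f : C(unitInterval, ℝ × ℝ)) (z : ℤ × ℤ)
    (hf : ∀ t, cover (f t) = γ.1 t) (hz : f 1 = f 0 + latticePoint z) :
    Quotient.mk (freeHomotopySetoid Torus) γ = lineClass z := by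
  refine Quotient.sound ⟨⟨⟨⟨fun p => cover ((1 - (p.1 : ℝ)) • f p.2 +
    (p.1 : ℝ) • ((p.2 : ℝ) • latticePoint z)), ?_⟩, ?_, ?_⟩, ?_⟩⟩
  · exact continuous_cover.comp (by fun_prop)
  · intro t
    simp [hf]
  · intro t
    simp [Loop.ofPath, linePath]
  · intro u
    simp only [ContinuousMap.coe_mk, hz]
    rw [eq_comm, cover_eq_cover_iff]
    refine ⟨z, ?_⟩
    simp only [Set.Icc.coe_one, Set.Icc.coe_zero, zero_smul, one_smul, smul_zero]
    module

theorem ofPath_eq_lineClass {x : Torus} (p : Path x x) (f : C(unitInterval, ℝ × ℝ)) (z : ℤ × ℤ)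
    (hf : ∀ t, cover (f t) = p t) (hz : f 1 = f 0 + latticePoint z) :
    FreeClass.ofPath p = lineClass z :=
  mk_eq_lineClass _ f z hf hz

theorem homotopic_of_lifts {x y : Torus} (p q : Path x y) (f g : C(unitInterval, ℝ × ℝ))
    (hf : ∀ t, cover (f t) = p t) (hg : ∀ t, cover (g t) = q t) (h0 : f 0 = g 0)
    (h1 : f 1 = g 1) : p.Homotopic q := by
  refine ⟨⟨⟨⟨fun r => cover ((1 - (r.1 : ℝ)) • f r.2 + (r.1 : ℝ) • g r.2), ?_⟩, ?_, ?_⟩, ?_⟩⟩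
  · exact continuous_cover.comp (by fun_prop)
  · intro t
    simp [hf]
  · intro t
    simp [hg]
  · rintro u t (rfl | rfl)
    · have : (1 - (u : ℝ)) • f 0 + (u : ℝ) • g 0 = f 0 := by rw [h0]; module
      simp [this, hf]
    · have : (1 - (u : ℝ)) • f 1 + (u : ℝ) • g 1 = f 1 := by rw [h1]; module
      simp [this, hf]

/-- The segment in the plane from `v` to `v + w`. -/
def segmentPath (v w : ℝ × ℝ) : Path v (v + w) where
  toFun t := v + (t : ℝ) • w
  continuous_toFun := by fun_prop
  source' := by simp
  target' := by simp

theorem linePath_add_homotopic (z w : ℤ × ℤ) :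
    (linePath (z + w)).Homotopic ((linePath z).trans (linePath w)) := by
  refine homotopic_of_lifts _ _
    (segmentPath 0 (latticePoint (z + w))).toContinuousMap
    ((segmentPath 0 (latticePoint z)).trans
      (segmentPath (0 + latticePoint z) (latticePoint w))).toContinuousMap ?_ ?_ ?_ ?_
  · intro t
    simp [segmentPath, linePath]
  · intro t
    simp only [Path.coe_toContinuousMap, Path.trans_apply]
    split_ifs
    · simp [segmentPath, linePath]
    · simp [segmentPath, linePath, cover_add, cover_latticePoint]
  · simp
  · simp [latticePoint_add]

/-- The homomorphism from the lattice to the fundamental group given by straight paths. -/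
def lineHom : Multiplicative (ℤ × ℤ) →* FundamentalGroup Torus 0 :=
  MonoidHom.mk' (fun z => FundamentalGroup.fromPath
      (Path.Homotopic.Quotient.mk (linePath z.toAdd))) (by
    intro z w
    -- Commutativity of the lattice matches the order in which the fundamental group composes paths.
    rw [FundamentalGroup.mul_def, mul_comm]
    exact Quotient.sound (linePath_add_homotopic _ _))

theorem lineHom_fst : lineHom (Multiplicative.ofAdd (1, 0)) = genA := by
  have : linePath (1, 0) = pathA := by
    ext t <;> simp [linePath, pathA, latticePoint] <;> rfl
  simp [lineHom, genA, this]

theorem lineHom_snd : lineHom (Multiplicative.ofAdd (0, 1)) = genB := by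
  have : linePath (0, 1) = pathB := by
    ext t <;> simp [linePath, pathB, latticePoint] <;> rfl
  simp [lineHom, genB, this]

theorem word_eq (i j : ℤ) : word i j = Finsupp.single (lineClass (i, j)) 1 := by
  have h : genA ^ i * genB ^ j = lineHom (Multiplicative.ofAdd (i, j)) := by
    rw [← lineHom_fst, ← lineHom_snd, ← map_zpow lineHom, ← map_zpow lineHom, ← map_mul, ← ofAdd_zsmul,
      ← ofAdd_zsmul, ← ofAdd_add]
    simp
  rw [word, h]
  rfl

/-! ### Integer-valued continuous functions and the invariance of the winding numbers -/

/-- The lattice is discrete, so connectedness forces constancy. All invariance of winding numbers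
below rests on this. -/
theorem eq_of_forall_exists_latticePoint {X : Type*} [TopologicalSpace X] [PreconnectedSpace X]
    {f : X → ℝ × ℝ} (hf : Continuous f) (h : ∀ x, ∃ z, f x = latticePoint z) (x y : X) :
    f x = f y := by
  have key : ∀ g : X → ℝ, Continuous g → (∀ x, ∃ n : ℤ, g x = n) → g x = g y := by
    intro g hg hn
    choose n hn using hn
    have hnc : Continuous n := by
      rw [Int.isClosedEmbedding_coe_real.isInducing.continuous_iff]
      exact hg.congr hn
    rw [hn x, hn y, PreconnectedSpace.constant inferInstance hnc]
  refine Prod.ext (key _ hf.fst fun x => ?_) (key _ hf.snd fun x => ?_)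
  · obtain ⟨z, hz⟩ := h x
    exact ⟨z.1, by rw [hz]; rfl⟩
  · obtain ⟨z, hz⟩ := h x
    exact ⟨z.2, by rw [hz]; rfl⟩

theorem isCoveringMap_unitAddCircle : IsCoveringMap ((↑) : ℝ → UnitAddCircle) :=
  AddCircle.isCoveringMap_coe 1

theorem exists_lift_square (H : C(unitInterval × unitInterval, Torus)) :
    ∃ F : C(unitInterval × unitInterval, ℝ × ℝ), ∀ p, cover (F p) = H p := by
  have key : ∀ h : C(unitInterval × unitInterval, UnitAddCircle),
      ∃ F : C(unitInterval × unitInterval, ℝ), ∀ p, (F p : UnitAddCircle) = h p := by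
    intro h
    -- Clamping both parameters extends `h` to the plane, which is simply connected, so a lift
    -- exists; it is then restricted to the square.
    let r : C(ℝ, unitInterval) := ⟨Set.projIcc 0 1 zero_le_one, continuous_projIcc⟩
    obtain ⟨e, he⟩ := QuotientAddGroup.mk_surjective (h (r 0, r 0))
    obtain ⟨F, ⟨-, hF⟩, -⟩ := isCoveringMap_unitAddCircle.existsUnique_continuousMap_lifts
      (h.comp (r.prodMap r)) (0, 0) e he
    refine ⟨F.comp ⟨fun p => ((p.1 : ℝ), (p.2 : ℝ)), by fun_prop⟩, fun p => ?_⟩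
    refine (congrFun hF ((p.1 : ℝ), (p.2 : ℝ))).trans ?_
    simp [r]
  obtain ⟨F, hF⟩ := key ⟨fun p => (H p).1, by fun_prop⟩
  obtain ⟨G, hG⟩ := key ⟨fun p => (H p).2, by fun_prop⟩
  exact ⟨F.prodMk G, fun p => Prod.ext (hF p) (hG p)⟩

theorem exists_latticePoint_sub {v w : ℝ × ℝ} (h : cover v = cover w) :
    ∃ z, v - w = latticePoint z := by
  obtain ⟨z, rfl⟩ := cover_eq_cover_iff.1 h
  exact ⟨z, by simp⟩

/-- In a lift of a free homotopy, the difference of the ends at stage u is a lattice point depending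
continuously on u, hence constant; at the two extreme stages it is z and w. -/
theorem lineClass_injective : Function.Injective lineClass := by
  intro z w h
  obtain ⟨H⟩ : ContinuousMap.HomotopicWith (Loop.ofPath (linePath z)).1
    (Loop.ofPath (linePath w)).1 (fun f => f 0 = f 1) := Quotient.exact h
  obtain ⟨F, hF⟩ := exists_lift_square H.toContinuousMap
  have hF' : ∀ p, cover (F p) = H p := hF
  have hend : F (0, 1) - F (0, 0) = F (1, 1) - F (1, 0) := by
    refine eq_of_forall_exists_latticePoint (f := fun u => F (u, 1) - F (u, 0))
      (by fun_prop) (fun u => exists_latticePoint_sub ?_) 0 1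
    rw [hF', hF']
    exact (H.prop u).symm
  -- Two lifts of the same path differ by a constant.
  have side : ∀ (u : unitInterval) (z : ℤ × ℤ),
      (∀ t : unitInterval, H (u, t) = cover ((t : ℝ) • latticePoint z)) →
      F (u, 1) - F (u, 0) = latticePoint z := by
    intro u z hu
    have := eq_of_forall_exists_latticePoint
      (f := fun t : unitInterval => F (u, t) - (t : ℝ) • latticePoint z)
      (by fun_prop) (fun t => exists_latticePoint_sub (by rw [hF', hu])) 1 0
    simp only [Set.Icc.coe_one, Set.Icc.coe_zero, one_smul, zero_smul, sub_zero] at this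
    rw [← this]
    abel
  apply latticePoint_injective
  rw [← side 0 z fun t => H.apply_zero t, ← side 1 w fun t => H.apply_one t, hend]

/-! ### Periods of smooth loops -/

namespace SmoothLoop

theorem exists_period (α : SmoothLoop) :
    ∃ z : ℤ × ℤ, ∀ s, α.lift (s + 1) = α.lift s + latticePoint z := by
  have hc := α.smooth.continuous
  have h : ∀ s, ∃ z, α.lift (s + 1) - α.lift s = latticePoint z := fun s =>
    exists_latticePoint_sub (α.periodic s)
  obtain ⟨z, hz⟩ := h 0
  refine ⟨z, fun s => ?_⟩
  rw [← hz, eq_of_forall_exists_latticePoint (by fun_prop) h 0 s]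
  abel

/-- The pair of winding numbers of a smooth loop. -/
def period (α : SmoothLoop) : ℤ × ℤ := α.exists_period.choose

theorem lift_add_one (α : SmoothLoop) (s : ℝ) :
    α.lift (s + 1) = α.lift s + latticePoint α.period := α.exists_period.choose_spec s

theorem freeClass_eq (α : SmoothLoop) : α.freeClass = lineClass α.period := by
  have hc := α.smooth.continuous
  refine ofPath_eq_lineClass _ ⟨fun t => α.lift (0 + t), by fun_prop⟩ _ (fun t => rfl) ?_
  simpa using α.lift_add_one 0

end SmoothLoop

theorem smoothing_eq (α β : SmoothLoop) (p : crossings α β) :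
    smoothing α β p = lineClass (α.period + β.period) := by
  obtain ⟨⟨s, t⟩, hs, ht, hst⟩ := p
  have hα := α.smooth.continuous
  have hβ := β.smooth.continuous
  obtain ⟨z, hz⟩ := cover_eq_cover_iff.1 hst
  simp only at hz hst
  let q₁ : Path (α.lift s) (α.lift (s + 1)) :=
    { toFun := fun u => α.lift (s + u)
      continuous_toFun := by fun_prop
      source' := by simp
      target' := by simp }
  -- The lift of β is translated by z to meet that of α at the crossing, then by the period of α to
  -- start where the first lap ends.
  let q₂ : Path (α.lift (s + 1)) (α.lift (s + 1) + latticePoint β.period) :=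
    { toFun := fun u => β.lift (t + u) + latticePoint (z + α.period)
      continuous_toFun := by fun_prop
      source' := by simp [α.lift_add_one, hz, latticePoint_add, add_assoc]
      target' := by
        rw [Set.Icc.coe_one, α.lift_add_one, β.lift_add_one, hz, latticePoint_add]
        abel }
  refine ofPath_eq_lineClass _ (q₁.trans q₂).toContinuousMap _ (fun u => ?_) ?_
  · simp only [Path.coe_toContinuousMap, Path.trans_apply]
    split_ifs
    · rfl
    · exact cover_add_latticePoint _ _
  · simp [α.lift_add_one, latticePoint_add, add_assoc]

/-! ### Fourier modes along smooth loops -/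

/-- The universal covering of the torus, seen as a family of circles. -/
def coverPi (v : ℝ × ℝ) : UnitAddTorus (Fin 2) := ![(v.1 : UnitAddCircle), (v.2 : UnitAddCircle)]

theorem continuous_coverPi : Continuous coverPi := by
  refine continuous_pi fun i => ?_
  fin_cases i
  · exact (AddCircle.continuous_mk' 1).comp continuous_fst
  · exact (AddCircle.continuous_mk' 1).comp continuous_snd

theorem coverPi_eq_coverPi_iff {v w : ℝ × ℝ} : coverPi v = coverPi w ↔ cover v = cover w := by
  simp [coverPi, cover, funext_iff, Prod.ext_iff]

theorem coverPi_eq_zero_iff {v : ℝ × ℝ} : coverPi v = 0 ↔ cover v = 0 := by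
  simp [coverPi, cover, funext_iff, Prod.ext_iff]

/-- The exponential monomials on the plane. -/
def planeExp (m : Fin 2 → ℤ) (v : ℝ × ℝ) : ℂ :=
  Complex.exp (2 * Real.pi * Complex.I * (m 0 * v.1 + m 1 * v.2))

theorem mFourier_coverPi (m : Fin 2 → ℤ) (v : ℝ × ℝ) :
    UnitAddTorus.mFourier m (coverPi v) = planeExp m v := by
  simp only [UnitAddTorus.mFourier, ContinuousMap.coe_mk, Fin.prod_univ_two, coverPi,
    Matrix.cons_val_zero, Matrix.cons_val_one, fourier_coe_apply, planeExp, ← Complex.exp_add]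
  congr 1
  push_cast
  ring

theorem planeExp_sub (m : Fin 2 → ℤ) (v w : ℝ × ℝ) :
    planeExp m (v - w) = planeExp m v * planeExp (-m) w := by
  simp only [planeExp, ← Complex.exp_add, Prod.fst_sub, Prod.snd_sub, Pi.neg_apply]
  congr 1
  push_cast
  ring

theorem planeExp_add_latticePoint (m : Fin 2 → ℤ) (v : ℝ × ℝ) (z : ℤ × ℤ) :
    planeExp m (v + latticePoint z) = planeExp m v := by
  rw [← mFourier_coverPi, ← mFourier_coverPi,
    coverPi_eq_coverPi_iff.2 (cover_add_latticePoint v z)]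

@[fun_prop]
theorem continuous_planeExp (m : Fin 2 → ℤ) : Continuous (planeExp m) := by
  unfold planeExp
  fun_prop

namespace SmoothLoop

theorem hasDerivAt_lift (α : SmoothLoop) (s : ℝ) : HasDerivAt α.lift (α.velocity s) s :=
  (α.smooth.differentiable (by simp) s).hasDerivAt

theorem hasDerivAt_fst (α : SmoothLoop) (s : ℝ) :
    HasDerivAt (fun s => (α.lift s).1) (α.velocity s).1 s :=
  (ContinuousLinearMap.fst ℝ ℝ ℝ).hasFDerivAt.comp_hasDerivAt s (α.hasDerivAt_lift s)

theorem hasDerivAt_snd (α : SmoothLoop) (s : ℝ) :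
    HasDerivAt (fun s => (α.lift s).2) (α.velocity s).2 s :=
  (ContinuousLinearMap.snd ℝ ℝ ℝ).hasFDerivAt.comp_hasDerivAt s (α.hasDerivAt_lift s)

@[fun_prop]
theorem continuous_lift (α : SmoothLoop) : Continuous α.lift := α.smooth.continuous

@[fun_prop]
theorem continuous_velocity (α : SmoothLoop) : Continuous α.velocity :=
  α.smooth.continuous_deriv (by simp)

/-- The first coordinate of the Fourier coefficient of the velocity along a loop. -/
def coeffFst (α : SmoothLoop) (m : Fin 2 → ℤ) (a : ℝ) : ℂ :=
  ∫ s in a..a + 1, planeExp m (α.lift s) * ((α.velocity s).1 : ℂ)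

/-- The second coordinate of the Fourier coefficient of the velocity along a loop. -/
def coeffSnd (α : SmoothLoop) (m : Fin 2 → ℤ) (a : ℝ) : ℂ :=
  ∫ s in a..a + 1, planeExp m (α.lift s) * ((α.velocity s).2 : ℂ)

/-- Up to the factor 2πi, the left side is the integral over one period of the derivative of the
periodic function `planeExp m (α.lift s)`. -/
theorem coeff_orthogonal (α : SmoothLoop) (m : Fin 2 → ℤ) (a : ℝ) :
    m 0 * α.coeffFst m a + m 1 * α.coeffSnd m a = 0 := by
  have hd : ∀ s ∈ Set.uIcc a (a + 1), HasDerivAt (fun s => planeExp m (α.lift s))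
      (planeExp m (α.lift s) * (2 * Real.pi * Complex.I *
        (m 0 * ((α.velocity s).1 : ℂ) + m 1 * ((α.velocity s).2 : ℂ)))) s := fun s _ =>
    ((((α.hasDerivAt_fst s).ofReal_comp.const_mul (m 0 : ℂ)).add
      ((α.hasDerivAt_snd s).ofReal_comp.const_mul (m 1 : ℂ))).const_mul
        (2 * Real.pi * Complex.I)).cexp
  have hint := intervalIntegral.integral_eq_sub_of_hasDerivAt hd
    (Continuous.intervalIntegrable (by fun_prop) _ _)
  rw [α.lift_add_one, planeExp_add_latticePoint, sub_self] at hint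
  have hsplit : ∫ s in a..a + 1, planeExp m (α.lift s) * (2 * Real.pi * Complex.I *
        (m 0 * ((α.velocity s).1 : ℂ) + m 1 * ((α.velocity s).2 : ℂ))) =
      2 * Real.pi * Complex.I * (m 0 * α.coeffFst m a + m 1 * α.coeffSnd m a) := by
    rw [coeffFst, coeffSnd, ← intervalIntegral.integral_const_mul,
      ← intervalIntegral.integral_const_mul, ← intervalIntegral.integral_add
        (Continuous.intervalIntegrable (by fun_prop) _ _)
        (Continuous.intervalIntegrable (by fun_prop) _ _),
      ← intervalIntegral.integral_const_mul]
    congr 1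
    ext s
    ring
  rw [hsplit] at hint
  exact (mul_eq_zero.1 hint).resolve_left Complex.two_pi_I_ne_zero

theorem coeffFst_zero (α : SmoothLoop) (a : ℝ) : α.coeffFst 0 a = α.period.1 := by
  have h : ∫ s in a..a + 1, ((α.velocity s).1 : ℂ) =
      (((α.lift (a + 1)).1 : ℝ) : ℂ) - ((α.lift a).1 : ℝ) :=
    intervalIntegral.integral_eq_sub_of_hasDerivAt
      (fun s _ => (α.hasDerivAt_fst s).ofReal_comp)
      (Continuous.intervalIntegrable (by fun_prop) _ _)
  simp [coeffFst, planeExp, h, α.lift_add_one, latticePoint]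

theorem coeffSnd_zero (α : SmoothLoop) (a : ℝ) : α.coeffSnd 0 a = α.period.2 := by
  have h : ∫ s in a..a + 1, ((α.velocity s).2 : ℂ) =
      (((α.lift (a + 1)).2 : ℝ) : ℂ) - ((α.lift a).2 : ℝ) :=
    intervalIntegral.integral_eq_sub_of_hasDerivAt
      (fun s _ => (α.hasDerivAt_snd s).ofReal_comp)
      (Continuous.intervalIntegrable (by fun_prop) _ _)
  simp [coeffSnd, planeExp, h, α.lift_add_one, latticePoint]

end SmoothLoop

/-! ### The intersection integral -/

/-- The difference of the lifts of two loops; the loops meet where it is a lattice point. -/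
def diffMap (α β : SmoothLoop) (p : ℝ × ℝ) : ℝ × ℝ := α.lift p.1 - β.lift p.2

/-- The half-open unit square of parameters with lower left corner `p`. -/
def unitSquare (p : ℝ × ℝ) : Set (ℝ × ℝ) := Set.Ioc p.1 (p.1 + 1) ×ˢ Set.Ioc p.2 (p.2 + 1)

@[fun_prop]
theorem continuous_diffMap (α β : SmoothLoop) : Continuous (diffMap α β) := by
  unfold diffMap
  fun_prop

@[fun_prop]
theorem continuous_velocityDet (α β : SmoothLoop) : Continuous (velocityDet α β) := by
  unfold velocityDet
  fun_prop

theorem measurableSet_unitSquare (p : ℝ × ℝ) : MeasurableSet (unitSquare p) :=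
  measurableSet_Ioc.prod measurableSet_Ioc

theorem integrableOn_unitSquare {f : ℝ × ℝ → ℂ} (hf : Continuous f) (p : ℝ × ℝ) :
    IntegrableOn f (unitSquare p) :=
  (hf.continuousOn.integrableOn_compact (isCompact_Icc.prod isCompact_Icc)).mono_set
    (Set.prod_mono Set.Ioc_subset_Icc_self Set.Ioc_subset_Icc_self)

theorem continuous_comp_diffMap_mul (α β : SmoothLoop) (ρ : C(UnitAddTorus (Fin 2), ℂ)) :
    Continuous fun q => ρ (coverPi (diffMap α β q)) * (velocityDet α β q : ℂ) := by
  have := continuous_coverPi.comp (continuous_diffMap α β)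
  have := ρ.continuous.comp this
  exact this.mul (by fun_prop)

/-- The integral over the torus of parameters of a function of the difference of two loops, against
the Jacobian determinant. -/
def intersectionIntegral (α β : SmoothLoop) (p : ℝ × ℝ) : C(UnitAddTorus (Fin 2), ℂ) →L[ℂ] ℂ :=
  LinearMap.mkContinuous
    { toFun := fun ρ => ∫ q in unitSquare p,
        ρ (coverPi (diffMap α β q)) * (velocityDet α β q : ℂ)
      map_add' := fun ρ σ => by
        rw [← integral_add (integrableOn_unitSquare (continuous_comp_diffMap_mul α β ρ) p)
          (integrableOn_unitSquare (continuous_comp_diffMap_mul α β σ) p)]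
        simp only [ContinuousMap.add_apply, add_mul]
      map_smul' := fun c ρ => by
        simp only [ContinuousMap.smul_apply, smul_eq_mul, mul_assoc, integral_const_mul,
          RingHom.id_apply] }
    (∫ q in unitSquare p, ‖(velocityDet α β q : ℂ)‖) (fun ρ => by
      rw [mul_comm, ← integral_const_mul]
      refine norm_integral_le_of_norm_le
        (((integrableOn_unitSquare (by fun_prop) p).norm).const_mul _) (ae_of_all _ fun q => ?_)
      rw [norm_mul]
      exact mul_le_mul_of_nonneg_right (ρ.norm_coe_le_norm _) (norm_nonneg _))

theorem intersectionIntegral_apply (α β : SmoothLoop) (p : ℝ × ℝ)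
    (ρ : C(UnitAddTorus (Fin 2), ℂ)) :
    intersectionIntegral α β p ρ = ∫ q in unitSquare p,
      ρ (coverPi (diffMap α β q)) * (velocityDet α β q : ℂ) := rfl

/-- A character of a difference factors, so Fubini separates the two parameters. -/
theorem intersectionIntegral_mFourier (α β : SmoothLoop) (p : ℝ × ℝ) (m : Fin 2 → ℤ) :
    intersectionIntegral α β p (UnitAddTorus.mFourier m) =
      α.coeffFst m p.1 * β.coeffSnd (-m) p.2 - α.coeffSnd m p.1 * β.coeffFst (-m) p.2 := by
  simp only [SmoothLoop.coeffFst, SmoothLoop.coeffSnd,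
    intervalIntegral.integral_of_le (le_add_of_nonneg_right zero_le_one)]
  rw [← setIntegral_prod_mul, ← setIntegral_prod_mul, intersectionIntegral_apply]
  refine Eq.trans ?_ (integral_sub (integrableOn_unitSquare (by fun_prop) p)
    (integrableOn_unitSquare (by fun_prop) p))
  refine integral_congr_ae (ae_of_all _ fun q => ?_)
  simp only [mFourier_coverPi, diffMap, planeExp_sub, velocityDet]
  push_cast
  ring

/-- The coefficient vectors of α at m and of β at -m are both orthogonal to m ≠ 0 in ℂ², hence
parallel, and their determinant vanishes. -/
theorem intersectionIntegral_mFourier_of_ne (α β : SmoothLoop) (p : ℝ × ℝ) {m : Fin 2 → ℤ}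
    (hm : m ≠ 0) : intersectionIntegral α β p (UnitAddTorus.mFourier m) = 0 := by
  rw [intersectionIntegral_mFourier]
  have h₁ := α.coeff_orthogonal m p.1
  have h₂ := β.coeff_orthogonal (-m) p.2
  simp only [Pi.neg_apply, Int.cast_neg] at h₂
  by_cases h0 : m 0 = 0
  · have h1 : (m 1 : ℂ) ≠ 0 := by
      intro h
      refine hm (funext fun i => ?_)
      fin_cases i
      · exact h0
      · exact_mod_cast h
    refine (mul_eq_zero.1 (?_ : (m 1 : ℂ) * _ = 0)).resolve_left h1
    linear_combination -β.coeffFst (-m) p.2 * h₁ - α.coeffFst m p.1 * h₂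
  · have h1 : (m 0 : ℂ) ≠ 0 := by exact_mod_cast h0
    refine (mul_eq_zero.1 (?_ : (m 0 : ℂ) * _ = 0)).resolve_left h1
    linear_combination β.coeffSnd (-m) p.2 * h₁ + α.coeffSnd m p.1 * h₂

/-- The determinant of two integral vectors. -/
def latticeDet (z w : ℤ × ℤ) : ℤ := z.1 * w.2 - z.2 * w.1

theorem intersectionIntegral_mFourier_zero (α β : SmoothLoop) (p : ℝ × ℝ) :
    intersectionIntegral α β p (UnitAddTorus.mFourier 0) = latticeDet α.period β.period := by
  rw [intersectionIntegral_mFourier]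
  simp [SmoothLoop.coeffFst_zero, SmoothLoop.coeffSnd_zero, latticeDet]

/-- Both sides are continuous functionals agreeing on the characters, whose span is dense. -/
theorem intersectionIntegral_eq_smul (α β α' β' : SmoothLoop) (p p' : ℝ × ℝ)
    (h : latticeDet α'.period β'.period = 1) :
    intersectionIntegral α β p =
      (latticeDet α.period β.period : ℂ) • intersectionIntegral α' β' p' := by
  refine ContinuousLinearMap.ext_on (s := Set.range UnitAddTorus.mFourier) ?_ ?_
  · exact Submodule.dense_iff_topologicalClosure_eq_top.2 UnitAddTorus.span_mFourier_closure_eq_top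
  · rintro _ ⟨m, rfl⟩
    by_cases hm : m = 0
    · subst hm
      simp [intersectionIntegral_mFourier_zero, h]
    · simp [intersectionIntegral_mFourier_of_ne _ _ _ hm]

/-! ### Bump functions on the torus -/

/-- The tent function of radius `ε` around the origin of the torus. -/
def torusBump (ε : ℝ) : C(UnitAddTorus (Fin 2), ℂ) where
  toFun x := ((max 0 (ε - ‖x‖) : ℝ) : ℂ)
  continuous_toFun := by fun_prop

/-- The tent function of radius `ε` around the origin of the plane. -/
def planeBump (ε : ℝ) (v : ℝ × ℝ) : ℂ := ((max 0 (ε - ‖v‖) : ℝ) : ℂ)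

theorem planeBump_eq_zero {ε : ℝ} {v : ℝ × ℝ} (h : ε ≤ ‖v‖) : planeBump ε v = 0 := by
  simp [planeBump, max_eq_left (sub_nonpos.2 h)]

theorem torusBump_eq_zero {ε : ℝ} {x : UnitAddTorus (Fin 2)} (h : ε ≤ ‖x‖) :
    torusBump ε x = 0 := by
  simp [torusBump, max_eq_left (sub_nonpos.2 h)]

theorem norm_coverPi_of_norm_le {v : ℝ × ℝ} (h : ‖v‖ ≤ 1 / 2) : ‖coverPi v‖ = ‖v‖ := by
  have h₁ : |v.1| ≤ |(1 : ℝ)| / 2 := by rw [abs_one]; exact (norm_fst_le v).trans h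
  have h₂ : |v.2| ≤ |(1 : ℝ)| / 2 := by rw [abs_one]; exact (norm_snd_le v).trans h
  have e₁ := (AddCircle.norm_coe_eq_abs_iff 1 one_ne_zero).2 h₁
  have e₂ := (AddCircle.norm_coe_eq_abs_iff 1 one_ne_zero).2 h₂
  refine le_antisymm ((pi_norm_le_iff_of_nonneg (norm_nonneg _)).2 fun i => ?_) ?_
  · fin_cases i
    · exact e₁.trans_le (norm_fst_le v)
    · exact e₂.trans_le (norm_snd_le v)
  · exact max_le (e₁.symm.trans_le (norm_le_pi_norm (coverPi v) 0))
      (e₂.symm.trans_le (norm_le_pi_norm (coverPi v) 1))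

theorem torusBump_coverPi {v : ℝ × ℝ} {z : ℤ × ℤ} (h : ‖v - latticePoint z‖ ≤ 1 / 2) (ε : ℝ) :
    torusBump ε (coverPi v) = planeBump ε (v - latticePoint z) := by
  have : coverPi v = coverPi (v - latticePoint z) := by
    rw [coverPi_eq_coverPi_iff, cover_sub, cover_latticePoint, sub_zero]
  simp [torusBump, planeBump, this, norm_coverPi_of_norm_le h]

theorem integral_planeBump_ne_zero {ε : ℝ} (hε : 0 < ε) : ∫ v, planeBump ε v ≠ 0 := by
  have hc : Continuous fun v : ℝ × ℝ => max 0 (ε - ‖v‖) := by fun_prop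
  have hs : HasCompactSupport fun v : ℝ × ℝ => max 0 (ε - ‖v‖) :=
    HasCompactSupport.intro (isCompact_closedBall 0 ε) fun v hv => by
      simp only [Metric.mem_closedBall, dist_zero_right, not_le] at hv
      exact max_eq_left (by linarith)
  have hpos : 0 < ∫ v : ℝ × ℝ, max 0 (ε - ‖v‖) :=
    hc.integral_pos_of_hasCompactSupport_nonneg_nonzero hs (fun v => le_max_left _ _)
      (x := 0) (by simp [hε.le, hε.ne'])
  simp only [planeBump, integral_complex_ofReal]
  exact_mod_cast hpos.ne'

/-! ### The local contribution of an intersection -/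

theorem hasFDerivAt_diffMap (α β : SmoothLoop) (p : ℝ × ℝ) :
    HasFDerivAt (diffMap α β)
      (((ContinuousLinearMap.fst ℝ ℝ ℝ).smulRight (α.velocity p.1)) -
        (ContinuousLinearMap.snd ℝ ℝ ℝ).smulRight (β.velocity p.2)) p := by
  have h₁ := (α.hasDerivAt_lift p.1).hasFDerivAt.comp p
    (ContinuousLinearMap.fst ℝ ℝ ℝ).hasFDerivAt
  have h₂ := (β.hasDerivAt_lift p.2).hasFDerivAt.comp p
    (ContinuousLinearMap.snd ℝ ℝ ℝ).hasFDerivAt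
  exact h₁.sub h₂

theorem contDiff_diffMap (α β : SmoothLoop) : ContDiff ℝ ∞ (diffMap α β) :=
  (α.smooth.comp contDiff_fst).sub (β.smooth.comp contDiff_snd)

/-- The sign comes from subtracting β; it is harmless, since the change of variables uses only the
absolute value. -/
theorem det_fderiv_diffMap (α β : SmoothLoop) (p : ℝ × ℝ) :
    (fderiv ℝ (diffMap α β) p).det = -velocityDet α β p := by
  rw [(hasFDerivAt_diffMap α β p).fderiv, ContinuousLinearMap.det,
    ← LinearMap.det_toMatrix (Module.Basis.finTwoProd ℝ), Matrix.det_fin_two]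
  simp [LinearMap.toMatrix_apply, velocityDet]
  ring

/-- By the inverse function theorem the difference map is a chart near p, and there `velocityDet` is
the constant sign times the absolute Jacobian. The set `V` allows neighbourhoods of distinct
crossings to be kept disjoint. -/
theorem exists_local_contribution (α β : SmoothLoop) {p : ℝ × ℝ} (hp : cover (diffMap α β p) = 0)
    (hdet : velocityDet α β p ≠ 0) {V : Set (ℝ × ℝ)} (hV : IsOpen V) (hpV : p ∈ V) :
    ∃ U ⊆ V, IsOpen U ∧ p ∈ U ∧ ∀ᶠ ε in 𝓝[>] (0 : ℝ),
      ∫ q in U, torusBump ε (coverPi (diffMap α β q)) * (velocityDet α β q : ℂ) =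
        (crossingSign α β p : ℂ) * ∫ v, planeBump ε v := by
  obtain ⟨z, hz⟩ := cover_eq_zero_iff.1 hp
  set F := diffMap α β with hF
  have hd : (fderiv ℝ F p).det ≠ 0 := by rw [det_fderiv_diffMap]; exact neg_ne_zero.2 hdet
  have hstrict : HasStrictFDerivAt F
      ((fderiv ℝ F p).toContinuousLinearEquivOfDetNeZero hd : ℝ × ℝ →L[ℝ] ℝ × ℝ) p := by
    rw [ContinuousLinearMap.coe_toContinuousLinearEquivOfDetNeZero]
    exact (contDiff_diffMap α β).contDiffAt.hasStrictFDerivAt (by simp)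
  let e := hstrict.toOpenPartialHomeomorph F
  have hFc : Continuous F := continuous_diffMap α β
  have hDc := continuous_velocityDet α β
  -- On `U` the map is injective, the determinant has its sign at p, and values stay within 1/2 of
  -- the lattice point, where torus and plane norms agree.
  let U : Set (ℝ × ℝ) := e.source ∩ (V ∩ ({q | 0 < velocityDet α β q * velocityDet α β p} ∩
    F ⁻¹' Metric.ball (latticePoint z) (1 / 2)))
  have hU : IsOpen U := e.open_source.inter (hV.inter
    ((isOpen_lt continuous_const (hDc.mul continuous_const)).inter
      (Metric.isOpen_ball.preimage hFc)))
  have hpU : p ∈ U := by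
    refine ⟨hstrict.mem_toOpenPartialHomeomorph_source, hpV, ?_, ?_⟩
    · exact mul_self_pos.2 hdet
    · rw [Set.mem_preimage, hz]
      exact Metric.mem_ball_self (by norm_num)
  refine ⟨U, fun q hq => hq.2.1, hU, hpU, ?_⟩
  have himage : IsOpen (F '' U) := e.isOpen_image_of_subset_source hU Set.inter_subset_left
  -- For ε < δ the whole support of the bump lies in the image of `U`.
  obtain ⟨δ, hδ, hball⟩ := Metric.isOpen_iff.1 himage (latticePoint z) ⟨p, hpU, hz⟩
  filter_upwards [Ioo_mem_nhdsGT hδ] with ε hε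
  have hsign : ∀ q ∈ U, (velocityDet α β q : ℂ) =
      (crossingSign α β p : ℂ) * |velocityDet α β q| := by
    intro q hq
    have hq : 0 < velocityDet α β q * velocityDet α β p := hq.2.2.1
    rcases hdet.lt_or_gt with h | h
    · have hq : velocityDet α β q < 0 := by nlinarith
      simp [crossingSign, sign_neg h, abs_of_neg hq]
    · have hq : 0 < velocityDet α β q := by nlinarith
      simp [crossingSign, sign_pos h, abs_of_pos hq]
  have hcov := integral_image_eq_integral_abs_det_fderiv_smul volume hU.measurableSet
    (fun q _ => ((contDiff_diffMap α β).differentiable (by simp) q).hasFDerivAt.hasFDerivWithinAt)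
    (e.injOn.mono Set.inter_subset_left) (fun v => torusBump ε (coverPi v))
  calc ∫ q in U, torusBump ε (coverPi (F q)) * (velocityDet α β q : ℂ)
      = ∫ q in U, (crossingSign α β p : ℂ) *
          (|(fderiv ℝ F q).det| • torusBump ε (coverPi (F q))) := by
        refine setIntegral_congr_fun hU.measurableSet fun q hq => ?_
        simp only [det_fderiv_diffMap, hF, abs_neg, Complex.real_smul]
        rw [hsign q hq]
        ring
    _ = (crossingSign α β p : ℂ) * ∫ v in F '' U, torusBump ε (coverPi v) := by
        rw [integral_const_mul]
        exact congrArg _ hcov.symm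
    _ = (crossingSign α β p : ℂ) * ∫ v in F '' U, planeBump ε (v - latticePoint z) := by
        congr 1
        refine setIntegral_congr_fun himage.measurableSet ?_
        rintro _ ⟨q, hq, rfl⟩
        refine torusBump_coverPi (le_of_lt ?_) ε
        simpa [dist_eq_norm] using hq.2.2.2
    _ = (crossingSign α β p : ℂ) * ∫ v, planeBump ε v := by
        rw [setIntegral_eq_integral_of_forall_compl_eq_zero, integral_sub_right_eq_self]
        intro v hv
        refine planeBump_eq_zero (le_of_not_gt fun h => hv (hball ?_))
        rw [Metric.mem_ball, dist_eq_norm]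
        exact h.trans hε.2

/-! ### Localization of the intersection integral -/

/-- Outside small neighbourhoods of the crossings, compactness keeps the difference at a positive
distance from 0 in the torus, so a narrow bump sees only the local contributions. Crossings must
avoid the boundary of the square for these neighbourhoods to fit inside. -/
theorem eventually_intersectionIntegral_eq (α β : SmoothLoop) (a : ℝ × ℝ) (K : Finset (ℝ × ℝ))
    (hK : ∀ p ∈ Set.Icc a.1 (a.1 + 1) ×ˢ Set.Icc a.2 (a.2 + 1),
      cover (diffMap α β p) = 0 → p ∈ K)
    (hK' : ∀ p ∈ K, p ∈ Set.Ioo a.1 (a.1 + 1) ×ˢ Set.Ioo a.2 (a.2 + 1) ∧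
      cover (diffMap α β p) = 0 ∧ velocityDet α β p ≠ 0) :
    ∀ᶠ ε in 𝓝[>] (0 : ℝ), intersectionIntegral α β a (torusBump ε) =
      ((∑ p ∈ K, crossingSign α β p : ℤ) : ℂ) * ∫ v, planeBump ε v := by
  obtain ⟨W, hW, hdisj⟩ := K.finite_toSet.t2_separation
  have hopen : IsOpen (Set.Ioo a.1 (a.1 + 1) ×ˢ Set.Ioo a.2 (a.2 + 1)) :=
    isOpen_Ioo.prod isOpen_Ioo
  have hloc : ∀ p : ℝ × ℝ, ∃ U : Set (ℝ × ℝ), p ∈ K →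
      U ⊆ W p ∩ (Set.Ioo a.1 (a.1 + 1) ×ˢ Set.Ioo a.2 (a.2 + 1)) ∧ IsOpen U ∧ p ∈ U ∧
      ∀ᶠ ε in 𝓝[>] (0 : ℝ),
        ∫ q in U, torusBump ε (coverPi (diffMap α β q)) * (velocityDet α β q : ℂ) =
          (crossingSign α β p : ℂ) * ∫ v, planeBump ε v := by
    intro p
    by_cases hp : p ∈ K
    · obtain ⟨U, h₁, h₂⟩ := exists_local_contribution α β (hK' p hp).2.1 (hK' p hp).2.2
        ((hW p).2.inter hopen) ⟨(hW p).1, (hK' p hp).1⟩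
      exact ⟨U, fun _ => ⟨h₁, h₂⟩⟩
    · exact ⟨∅, fun h => absurd h hp⟩
  choose U hU using hloc
  let S : Set (ℝ × ℝ) := ⋃ p ∈ K, U p
  have hSopen : IsOpen S := isOpen_biUnion fun p hp => (hU p hp).2.1
  have hcompact : IsCompact ((Set.Icc a.1 (a.1 + 1) ×ˢ Set.Icc a.2 (a.2 + 1)) \ S) :=
    (isCompact_Icc.prod isCompact_Icc).diff hSopen
  obtain ⟨δ, hδ, hmin⟩ := hcompact.exists_forall_le' (f := fun q => ‖coverPi (diffMap α β q)‖)
    (a := 0) (continuous_coverPi.comp (continuous_diffMap α β)).norm.continuousOn (by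
      intro q hq
      refine norm_pos_iff.2 fun h => hq.2 ?_
      have hqK := hK q hq.1 (coverPi_eq_zero_iff.1 h)
      exact Set.mem_biUnion (show q ∈ (K : Set (ℝ × ℝ)) from hqK) (hU q hqK).2.2.1)
  have hall : ∀ᶠ ε in 𝓝[>] (0 : ℝ), ∀ p ∈ K,
      ∫ q in U p, torusBump ε (coverPi (diffMap α β q)) * (velocityDet α β q : ℂ) =
        (crossingSign α β p : ℂ) * ∫ v, planeBump ε v :=
    (eventually_all_finset K).2 fun p hp => (hU p hp).2.2.2
  filter_upwards [hall, Ioo_mem_nhdsGT hδ] with ε hε hεδ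
  have hSsub : S ⊆ unitSquare a := Set.iUnion₂_subset fun p hp =>
    ((hU p hp).1.trans Set.inter_subset_right).trans
      (Set.prod_mono Set.Ioo_subset_Ioc_self Set.Ioo_subset_Ioc_self)
  rw [intersectionIntegral_apply, setIntegral_eq_of_subset_of_forall_sdiff_eq_zero
    (measurableSet_unitSquare a) hSsub, integral_biUnion_finset]
  · rw [Finset.sum_congr rfl hε, Int.cast_sum, Finset.sum_mul]
  · exact fun p hp => (hU p hp).2.1.measurableSet
  · intro p hp q hq hpq
    exact (hdisj hp hq hpq).mono ((hU p hp).1.trans Set.inter_subset_left)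
      ((hU q hq).1.trans Set.inter_subset_left)
  · intro p hp
    exact (integrableOn_unitSquare (continuous_comp_diffMap_mul α β _) a).mono_set
      ((Set.subset_biUnion_of_mem (u := U) (show p ∈ (K : Set (ℝ × ℝ)) from hp)).trans hSsub)
  · intro q hq
    rw [torusBump_eq_zero, zero_mul]
    exact hεδ.2.le.trans (hmin q
      ⟨Set.prod_mono Set.Ioc_subset_Icc_self Set.Ioc_subset_Icc_self hq.1, hq.2⟩)

/-! ### Straight loops -/

/-- The straight loop with given winding numbers. -/
def lineLoop (z : ℤ × ℤ) : SmoothLoop where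
  lift s := s • latticePoint z
  smooth := by fun_prop
  periodic := fun s => by
    simp only [add_smul, one_smul]
    exact cover_add_latticePoint _ z

theorem period_lineLoop (z : ℤ × ℤ) : (lineLoop z).period = z := by
  have h := (lineLoop z).lift_add_one 0
  simp only [lineLoop, zero_add, one_smul, zero_smul] at h
  exact latticePoint_injective h.symm

theorem velocity_lineLoop (z : ℤ × ℤ) (s : ℝ) : (lineLoop z).velocity s = latticePoint z := by
  have h : HasDerivAt (fun s : ℝ => s • latticePoint z) ((1 : ℝ) • latticePoint z) s :=
    (hasDerivAt_id s).smul_const _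
  simpa [SmoothLoop.velocity, lineLoop] using h.deriv

theorem velocityDet_lineLoop (z w : ℤ × ℤ) (p : ℝ × ℝ) :
    velocityDet (lineLoop z) (lineLoop w) p = latticeDet z w := by
  simp [velocityDet, velocity_lineLoop, latticePoint, latticeDet]

/-- The difference map is linear and injective, and the bounded image of the parameter square
contains only finitely many lattice points. -/
theorem isTransverse_lineLoop {z w : ℤ × ℤ} (h : latticeDet z w ≠ 0) :
    IsTransverse (lineLoop z) (lineLoop w) := by
  have hd : (latticeDet z w : ℝ) ≠ 0 := by exact_mod_cast h
  refine ⟨?_, fun p _ => by rwa [velocityDet_lineLoop]⟩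
  have hinj : Function.Injective (diffMap (lineLoop z) (lineLoop w)) := by
    intro p q hpq
    simp only [diffMap, lineLoop, latticePoint, Prod.smul_mk, smul_eq_mul, Prod.mk_sub_mk,
      Prod.mk.injEq] at hpq
    obtain ⟨h₁, h₂⟩ := hpq
    simp only [latticeDet, Int.cast_sub, Int.cast_mul] at hd
    refine Prod.ext (mul_right_cancel₀ hd ?_) (mul_right_cancel₀ hd ?_)
    · linear_combination (w.2 : ℝ) * h₁ - w.1 * h₂
    · linear_combination (z.2 : ℝ) * h₁ - z.1 * h₂
  have hbdd : Bornology.IsBounded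
      (diffMap (lineLoop z) (lineLoop w) '' (Set.Icc 0 1 ×ˢ Set.Icc 0 1)) :=
    ((isCompact_Icc.prod isCompact_Icc).image (continuous_diffMap _ _)).isBounded
  obtain ⟨R, hR⟩ := hbdd.exists_norm_le
  have hfin : (Set.Icc (-⌈R⌉) ⌈R⌉ ×ˢ Set.Icc (-⌈R⌉) ⌈R⌉ : Set (ℤ × ℤ)).Finite :=
    (Set.finite_Icc _ _).prod (Set.finite_Icc _ _)
  refine ((hfin.image latticePoint).preimage (hinj.injOn)).subset ?_
  rintro p ⟨hp₁, hp₂, hp⟩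
  obtain ⟨u, hu⟩ := exists_latticePoint_sub hp
  have hnorm := hR _ ⟨p, ⟨Set.Ico_subset_Icc_self hp₁, Set.Ico_subset_Icc_self hp₂⟩, hu⟩
  have key : ∀ n : ℤ, |(n : ℝ)| ≤ R → n ∈ Set.Icc (-⌈R⌉) ⌈R⌉ := by
    intro n hn
    rw [Set.mem_Icc, ← abs_le]
    exact_mod_cast hn.trans (Int.le_ceil R)
  exact ⟨u, ⟨key _ ((norm_fst_le _).trans hnorm), key _ ((norm_snd_le _).trans hnorm)⟩, hu.symm⟩

/-! ### The algebraic intersection number -/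

theorem curve_eq_curve_iff (α β : SmoothLoop) (p : ℝ × ℝ) :
    α.curve p.1 = β.curve p.2 ↔ cover (diffMap α β p) = 0 := by
  rw [diffMap, cover_sub, sub_eq_zero]
  rfl

namespace SmoothLoop

theorem curve_sub_int (α : SmoothLoop) (s : ℝ) (n : ℤ) : α.curve (s - n) = α.curve s := by
  have h : Function.Periodic α.curve 1 := α.periodic
  simpa using h.sub_int_mul_eq n (x := s)

theorem periodic_velocity (α : SmoothLoop) : Function.Periodic α.velocity 1 := by
  intro s
  have h : (fun s => α.lift (s + 1)) = fun s => α.lift s + latticePoint α.period :=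
    funext α.lift_add_one
  have := congrFun (congrArg deriv h) s
  rwa [deriv_comp_add_const, deriv_add_const] at this

theorem velocity_sub_int (α : SmoothLoop) (s : ℝ) (n : ℤ) : α.velocity (s - n) = α.velocity s := by
  simpa using α.periodic_velocity.sub_int_mul_eq n (x := s)

end SmoothLoop

theorem eq_of_mem_Ico_of_sub_int {a x y : ℝ} (hx : x ∈ Set.Ico a (a + 1))
    (hy : y ∈ Set.Ico a (a + 1)) {m n : ℤ} (h : x - m = y - n) : x = y := by
  have h₁ : ((m - n : ℤ) : ℝ) < 1 := by push_cast; linarith [hx.2, hy.1]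
  have h₂ : (-1 : ℝ) < ((m - n : ℤ) : ℝ) := by push_cast; linarith [hx.1, hy.2]
  have h₃ : m - n < 1 := by exact_mod_cast h₁
  have h₄ : -1 < m - n := by exact_mod_cast h₂
  have : m = n := by omega
  rw [this] at h
  linarith

theorem exists_notMem_image {X : Type*} {s : Set X} (hs : s.Finite) (f : X → ℝ) :
    ∃ a : ℝ, ∀ x ∈ s, ∀ n : ℤ, f x ≠ a + n := by
  have hc : (Set.range fun r : s × ℤ => f r.1 - r.2).Countable := by
    have := hs.countable.to_subtype
    exact Set.countable_range _
  obtain ⟨a, ha⟩ := hc.dense_compl ℝ |>.nonempty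
  exact ⟨a, fun x hx n h => ha ⟨(⟨x, hx⟩, n), by simp [h]⟩⟩

theorem toIcoMod_one_eq (a x : ℝ) :
    ∃ n : ℤ, toIcoMod (zero_lt_one' ℝ) a x = x - n :=
  ⟨toIcoDiv (zero_lt_one' ℝ) a x, by simp [toIcoMod]⟩

theorem sum_crossingSign (α β : SmoothLoop) (h : IsTransverse α β) :
    ∑ p ∈ h.finite.toFinset, crossingSign α β p = latticeDet α.period β.period := by
  classical
  obtain ⟨a, ha⟩ := exists_notMem_image h.finite Prod.fst
  obtain ⟨b, hb⟩ := exists_notMem_image h.finite Prod.snd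
  -- Crossings are moved modulo 1 into a square with corner (a, b), chosen so that none lies on its
  -- boundary.
  let φ : ℝ × ℝ → ℝ × ℝ := fun p =>
    (toIcoMod (zero_lt_one' ℝ) a p.1, toIcoMod (zero_lt_one' ℝ) b p.2)
  have hφ : ∀ p, ∃ m n : ℤ, φ p = (p.1 - m, p.2 - n) := fun p => by
    obtain ⟨m, hm⟩ := toIcoMod_one_eq a p.1
    obtain ⟨n, hn⟩ := toIcoMod_one_eq b p.2
    exact ⟨m, n, Prod.ext hm hn⟩
  have hφ_det : ∀ p, velocityDet α β (φ p) = velocityDet α β p := fun p => by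
    obtain ⟨m, n, hmn⟩ := hφ p
    simp only [velocityDet, hmn, SmoothLoop.velocity_sub_int]
  have hφ_cross : ∀ p ∈ crossings α β, cover (diffMap α β (φ p)) = 0 := fun p hp => by
    obtain ⟨m, n, hmn⟩ := hφ p
    rw [← curve_eq_curve_iff, hmn, SmoothLoop.curve_sub_int, SmoothLoop.curve_sub_int]
    exact hp.2.2
  have hinj : Set.InjOn φ h.finite.toFinset := by
    intro p hp q hq hpq
    simp only [Set.Finite.coe_toFinset] at hp hq
    obtain ⟨m, n, hmn⟩ := hφ p
    obtain ⟨m', n', hmn'⟩ := hφ q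
    rw [hmn, hmn', Prod.mk.injEq] at hpq
    exact Prod.ext
      (eq_of_mem_Ico_of_sub_int (a := 0) (by simpa using hp.1) (by simpa using hq.1) hpq.1)
      (eq_of_mem_Ico_of_sub_int (a := 0) (by simpa using hp.2.1) (by simpa using hq.2.1) hpq.2)
  have hcover : ∀ p ∈ Set.Icc (a, b).1 ((a, b).1 + 1) ×ˢ Set.Icc (a, b).2 ((a, b).2 + 1),
      cover (diffMap α β p) = 0 → p ∈ h.finite.toFinset.image φ := by
    rintro ⟨s, t⟩ ⟨hs, ht⟩ hst
    simp only at hs ht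
    rw [← curve_eq_curve_iff] at hst
    have hq : (s - ⌊s⌋, t - ⌊t⌋) ∈ crossings α β := by
      refine ⟨⟨Int.fract_nonneg s, Int.fract_lt_one s⟩, ⟨Int.fract_nonneg t, Int.fract_lt_one t⟩,
        ?_⟩
      simpa only [SmoothLoop.curve_sub_int] using hst
    have hs' : s ≠ a + 1 := fun h' => ha _ hq (1 - ⌊s⌋) (by push_cast; linarith)
    have ht' : t ≠ b + 1 := fun h' => hb _ hq (1 - ⌊t⌋) (by push_cast; linarith)
    refine Finset.mem_image.2 ⟨_, h.finite.mem_toFinset.2 hq, ?_⟩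
    obtain ⟨m, hm⟩ := toIcoMod_one_eq a (s - ⌊s⌋)
    obtain ⟨n, hn⟩ := toIcoMod_one_eq b (t - ⌊t⌋)
    refine Prod.ext ?_ ?_
    · exact eq_of_mem_Ico_of_sub_int (toIcoMod_mem_Ico _ a _) ⟨hs.1, hs.2.lt_of_ne hs'⟩
        (m := 0) (n := ⌊s⌋ + m) (by push_cast; linarith)
    · exact eq_of_mem_Ico_of_sub_int (toIcoMod_mem_Ico _ b _) ⟨ht.1, ht.2.lt_of_ne ht'⟩
        (m := 0) (n := ⌊t⌋ + n) (by push_cast; linarith)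
  have hinterior : ∀ p ∈ h.finite.toFinset.image φ,
      p ∈ Set.Ioo (a, b).1 ((a, b).1 + 1) ×ˢ Set.Ioo (a, b).2 ((a, b).2 + 1) ∧
        cover (diffMap α β p) = 0 ∧ velocityDet α β p ≠ 0 := by
    intro p hp
    obtain ⟨q, hq, rfl⟩ := Finset.mem_image.1 hp
    rw [Set.Finite.mem_toFinset] at hq
    refine ⟨⟨?_, ?_⟩, hφ_cross q hq, by rw [hφ_det]; exact h.transverse q hq⟩
    · obtain ⟨m, hm⟩ := toIcoMod_one_eq a q.1
      have := toIcoMod_mem_Ico (zero_lt_one' ℝ) a q.1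
      exact ⟨this.1.lt_of_ne fun h' => ha q hq m (by linarith), this.2⟩
    · obtain ⟨n, hn⟩ := toIcoMod_one_eq b q.2
      have := toIcoMod_mem_Ico (zero_lt_one' ℝ) b q.2
      exact ⟨this.1.lt_of_ne fun h' => hb q hq n (by linarith), this.2⟩
  have hsum : ∑ p ∈ h.finite.toFinset.image φ, crossingSign α β p =
      ∑ p ∈ h.finite.toFinset, crossingSign α β p := by
    rw [Finset.sum_image hinj]
    exact Finset.sum_congr rfl fun p _ => by rw [crossingSign, crossingSign, hφ_det]
  have hev := eventually_intersectionIntegral_eq α β (a, b) _ hcover hinterior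
  have hstd_det : latticeDet (1, 0) (0, 1) = 1 := by simp [latticeDet]
  -- The square centred at the origin puts the only crossing of the coordinate circles in its
  -- interior.
  have hstd := eventually_intersectionIntegral_eq (lineLoop (1, 0)) (lineLoop (0, 1))
    (-1 / 2, -1 / 2) {(0, 0)} (by
      rintro ⟨s, t⟩ ⟨hs, ht⟩ hst
      simp only [Set.mem_Icc] at hs ht
      obtain ⟨⟨m, n⟩, hz⟩ := cover_eq_zero_iff.1 hst
      simp only [diffMap, lineLoop, latticePoint, Prod.smul_mk, smul_eq_mul, Prod.mk_sub_mk,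
        Prod.mk.injEq, Int.cast_one, Int.cast_zero, mul_one, mul_zero, sub_zero, zero_sub] at hz
      have key : ∀ k : ℤ, -1 < (k : ℝ) → (k : ℝ) < 1 → k = 0 := fun k h₁ h₂ => by
        have h₁ : -1 < k := by exact_mod_cast h₁
        have h₂ : k < 1 := by exact_mod_cast h₂
        omega
      have hm := key m (by linarith) (by linarith)
      have hn := key n (by linarith) (by linarith)
      subst hm hn
      simpa using hz) (by
      intro p hp
      rw [Finset.mem_singleton] at hp
      subst hp
      refine ⟨by norm_num, by simp [diffMap, lineLoop, cover], ?_⟩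
      rw [velocityDet_lineLoop, hstd_det]
      norm_num)
  -- A single ε serves both pairs, so the nonzero integral of the bump cancels.
  obtain ⟨ε, hε, hε', hpos⟩ := (hev.and (hstd.and self_mem_nhdsWithin)).exists
  rw [intersectionIntegral_eq_smul α β (lineLoop (1, 0)) (lineLoop (0, 1)) (a, b)
    (-1 / 2, -1 / 2) (by rw [period_lineLoop, period_lineLoop, hstd_det]),
    _root_.smul_apply, hε', hsum, Finset.sum_singleton, crossingSign,
    velocityDet_lineLoop, hstd_det] at hε
  simp only [Int.cast_one, sign_one, SignType.coe_one, one_mul, smul_eq_mul] at hε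
  exact_mod_cast (mul_right_cancel₀ (integral_planeBump_ne_zero hpos) hε).symm

/-! ### The bracket -/

theorem crossingSum_eq (α β : SmoothLoop) (h : IsTransverse α β) :
    crossingSum α β =
      Finsupp.single (lineClass (α.period + β.period)) (latticeDet α.period β.period) := by
  have := h.finite.fintype
  rw [crossingSum, finsum_eq_sum_of_fintype, ← sum_crossingSign α β h, Finsupp.single_finsetSum]
  simp only [smoothing_eq]
  exact (Finset.sum_subtype h.finite.toFinset (fun p => h.finite.mem_toFinset) fun p =>
    Finsupp.single (lineClass (α.period + β.period)) (crossingSign α β p)).symm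

/-- Whichever representatives are chosen, the sum depends only on their periods. -/
theorem bracketClass_lineClass (z w : ℤ × ℤ) :
    bracketClass (lineClass z) (lineClass w) =
      Finsupp.single (lineClass (z + w)) (latticeDet z w) := by
  unfold bracketClass
  split_ifs with h
  · obtain ⟨hz, hw, ht⟩ := h.choose_spec
    rw [SmoothLoop.freeClass_eq] at hz hw
    rw [crossingSum_eq _ _ ht, lineClass_injective hz, lineClass_injective hw]
  -- The default value 0 is correct: with a nonzero determinant the straight loops would be
  -- transverse representatives.
  · have hd : latticeDet z w = 0 := by
      by_contra hd
      refine h ⟨(lineLoop z, lineLoop w), ?_, ?_, isTransverse_lineLoop hd⟩ <;>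
        rw [SmoothLoop.freeClass_eq, period_lineLoop]
    rw [hd, Finsupp.single_zero]

/-- This bounds the derived algebra without first showing that every free class is a `lineClass`. -/
theorem bracketClass_eq_zero_or (x y : FreeClass Torus) :
    bracketClass x y = 0 ∨ ∃ z w, bracketClass x y =
      Finsupp.single (lineClass (z + w)) (latticeDet z w) := by
  unfold bracketClass
  split_ifs with h
  · exact Or.inr ⟨_, _, crossingSum_eq _ _ h.choose_spec.2.2⟩
  · exact Or.inl rfl

theorem bracket_word_word (i j k l : ℤ) :
    bracket (word i j) (word k l) = (i * l - j * k) • word (i + k) (j + l) := by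
  simp [bracket, word_eq, bracketClass_lineClass, latticeDet]

/-! ### Divisibility, Bézout and the lower central series -/

/-- The submodule spanned by the multiples `gcd(i, j) aⁱbʲ` of the basis elements. -/
def gcdSpan : Submodule ℤ GoldmanModule :=
  Submodule.span ℤ {x | ∃ i j : ℤ, x = (Int.gcd i j : ℤ) • word i j}

theorem smul_word_mem_gcdSpan {n i j : ℤ} (h : (Int.gcd i j : ℤ) ∣ n) :
    n • word i j ∈ gcdSpan := by
  obtain ⟨c, rfl⟩ := h
  rw [mul_comm, mul_smul]
  exact Submodule.smul_mem _ _ (Submodule.subset_span ⟨i, j, rfl⟩)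

theorem derivedAlgebra_le_gcdSpan : derivedAlgebra ≤ gcdSpan := by
  refine Submodule.map₂_le.2 fun x _ y _ => ?_
  simp only [bracket, Finsupp.linearCombination_apply, Finsupp.sum, LinearMap.sum_apply,
    LinearMap.smul_apply]
  refine Submodule.sum_mem _ fun c _ => Submodule.smul_mem _ _
    (Submodule.sum_mem _ fun d _ => Submodule.smul_mem _ _ ?_)
  rcases bracketClass_eq_zero_or c d with h | ⟨⟨i, j⟩, ⟨k, l⟩, h⟩
  · rw [h]
    exact zero_mem _
  · have hword : bracketClass c d = (i * l - j * k) • word (i + k) (j + l) := by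
      rw [h, word_eq]
      simp [latticeDet]
    rw [hword]
    refine smul_word_mem_gcdSpan ?_
    have : i * l - j * k = i * (j + l) - j * (i + k) := by ring
    rw [this]
    exact dvd_sub (dvd_mul_of_dvd_right (Int.gcd_dvd_right _ _) _)
      (dvd_mul_of_dvd_right (Int.gcd_dvd_left _ _) _)

/-- Words with coprime exponents lie in `gcdSpan`, and bracketing with them already produces every
generator. The general `H` serves every step of the series. -/
theorem gcdSpan_le_map₂ {H : Submodule ℤ GoldmanModule} (hH : gcdSpan ≤ H) :
    gcdSpan ≤ Submodule.map₂ bracket ⊤ H := by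
  refine Submodule.span_le.2 ?_
  rintro _ ⟨i, j, rfl⟩
  by_cases h0 : Int.gcd i j = 0
  · simp [h0]
  have hg : (Int.gcd i j : ℤ) ≠ 0 := by exact_mod_cast h0
  obtain ⟨i', hi⟩ := Int.gcd_dvd_left i j
  obtain ⟨j', hj⟩ := Int.gcd_dvd_right i j
  have hbez := Int.gcd_eq_gcd_ab i j
  -- Bézout coefficients, with one sign changed so that the identity reads as a determinant.
  set l := Int.gcdA i j
  set k := -Int.gcdB i j with hk
  have hdet : i * l - j * k = Int.gcd i j := by rw [hbez, hk]; ring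
  have hone : i' * l - j' * k = 1 := by
    refine mul_left_cancel₀ hg ?_
    linear_combination hdet - l * hi + k * hj
  have hkl : (Int.gcd k l : ℤ) ∣ 1 := by
    rw [← hone]
    exact dvd_sub (dvd_mul_of_dvd_right (Int.gcd_dvd_right _ _) _)
      (dvd_mul_of_dvd_right (Int.gcd_dvd_left _ _) _)
  have hmem : word k l ∈ H := hH (by simpa using smul_word_mem_gcdSpan hkl)
  have hbr : bracket (word (i - k) (j - l)) (word k l) = (Int.gcd i j : ℤ) • word i j := by
    rw [bracket_word_word, sub_add_cancel, sub_add_cancel, ← hdet]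
    congr 1
    ring
  rw [← hbr]
  exact Submodule.apply_mem_map₂ _ Submodule.mem_top hmem

theorem derivedAlgebra_eq_gcdSpan : derivedAlgebra = gcdSpan :=
  le_antisymm derivedAlgebra_le_gcdSpan (gcdSpan_le_map₂ le_top)

theorem lowerCentralSeries_succ_eq (i : ℕ) : lowerCentralSeries (i + 1) = gcdSpan := by
  induction i with
  | zero => exact derivedAlgebra_eq_gcdSpan
  | succ i ih =>
    refine le_antisymm ?_ (gcdSpan_le_map₂ ih.ge)
    exact (Submodule.map₂_le_map₂_right le_top).trans derivedAlgebra_eq_gcdSpan.le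

end Goldman

end

theorem mainTheorem5 :
    (∀ i : ℕ, 1 ≤ i → Goldman.lowerCentralSeries i = Goldman.derivedAlgebra) ∧
      Goldman.derivedAlgebra =
        Submodule.span ℤ
          ({x | ∃ i j : ℤ, x = (Int.gcd i j : ℤ) • Goldman.word i j} ∪
            {x | ∃ n : ℤ, n ≠ 0 ∧ x = n • Goldman.word n 0} ∪
            {x | ∃ n : ℤ, n ≠ 0 ∧ x = n • Goldman.word 0 n}) := by
  constructor
  · intro i hi
    obtain ⟨k, rfl⟩ := Nat.exists_eq_add_of_le' hi
    rw [Goldman.lowerCentralSeries_succ_eq, Goldman.derivedAlgebra_eq_gcdSpan]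
  · rw [Goldman.derivedAlgebra_eq_gcdSpan]
    -- The two families of pure powers are redundant, since gcd(n, 0) = |n| divides n.
    refine le_antisymm (Submodule.span_mono fun x hx => Or.inl (Or.inl hx))
      (Submodule.span_le.2 ?_)
    rintro _ ((⟨i, j, rfl⟩ | ⟨n, -, rfl⟩) | ⟨n, -, rfl⟩)
    · exact Goldman.smul_word_mem_gcdSpan dvd_rfl
    · exact Goldman.smul_word_mem_gcdSpan (by simp)
    · exact Goldman.smul_word_mem_gcdSpan (by simp)
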